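/- There are absolute constants $c_0\in(0,1)$ and $c_1>0$ such that the following holds. Let $m\ge 1$, let $A\in\mathbb{R}^{m\times m}$ and $C\in\mathbb{R}^{n\times n}$ be symmetric, $B\in\mathbb{R}^{n\times m}$, $z^*=(x^*,y^*)\in\mathbb{R}^n\times\mathbb{R}^m$, and $$f(x;y)=-\tfrac12(y-y^*)^\top A(y-y^*)+(x-x^*)^\top B(y-y^*)+\tfrac12(x-x^*)^\top C(x-x^*).$$ Suppose that $\mu I\le A\le LI$ with $\mu>0$, that $\|B\|_2\le L$ and $\|C\|_2\le L$, and that $C+BA^{-1}B^\top\ge\mu_x I$ with $0<\mu_x\le L$. Put $\kappa=L/\mu$ and $\kappa_x=L/\mu_x$, let $r\ge 2\kappa$, $\eta_x=\frac1{4rL}$, $\eta_y=\frac1{4L}$, and $$M=\begin{pmatrix}-C&-B\\ rB^\top&-rA\end{pmatrix}.$$ Let $M=P^{-1}JP$ be any Jordan decomposition of $M$ over $\mathbb{C}$ ($M$ need not be diagonalizable), let $s$ be the size of the largest Jordan block of $J$, and let $C_P=\|P\|_2\|P^{-1}\|_2$. Let $z^0\in\mathbb{R}^n\times\mathbb{R}^m$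 be arbitrary and let $z^T=(x^T,y^T)$ be the iterates, with exact gradients, of either gradient descent ascent (GDA), $$x^{k+1}=x^k-\eta_x\nabla_xf(x^k;y^k),\qquad y^{k+1}=y^k+\eta_y\nabla_yf(x^k;y^k),$$ or extra-gradient (EG), $$x^{k+1/2}=x^k-\eta_x\nabla_xf(x^k;y^k),\qquad y^{k+1/2}=y^k+\eta_y\nabla_yf(x^k;y^k),$$ $$x^{k+1}=x^k-\eta_x\nabla_xf(x^{k+1/2};y^{k+1/2}),\qquad y^{k+1}=y^k+\eta_y\nabla_yf(x^{k+1/2};y^{k+1/2}).$$ Then for every integer $T\ge1$, and also for $T=0$ if $s=1$ (with $0^0=1$), $$\|z^T-z^*\|_2\le s\,C_P\,\|z^0-z^*\|_2\,T^{s-1}\Bigl(1-\frac{c_0}{r\kappa_x}\Bigr)^{T-s+1}.$$ Moreover, for every $0<\varepsilon\le\|z^0-z^*\|_2$ there is a number of iterations $T_0$, using in total ($1$ gradient evaluation per iteration for GDA, $2$ for EG) at most $$c_1\,s\,r\,\kappa_x\log\Bigl(\frac{s\,r\,\kappa_x\,C_P\,\|z^0-z^*\|_2}{\varepsilon}\Bigr)$$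 gradient evaluations, such that $\|z^T-z^*\|_2\le\varepsilon$ for all $T\ge T_0$. -/

import Mathlib

open scoped Matrix.Norms.L2Operator

noncomputable section

namespace Minimax

/-- The space `ℝⁿ × ℝᵐ` with the Euclidean norm `‖(x, y)‖² = ‖x‖² + ‖y‖²`. -/
abbrev Pt (n m : ℕ) : Type :=
  WithLp 2 (EuclideanSpace ℝ (Fin n) × EuclideanSpace ℝ (Fin m))

/-- The partial gradient of `f` with respect to the minimization variable `x`. -/
def gradX {n m : ℕ} (f : EuclideanSpace ℝ (Fin n) → EuclideanSpace ℝ (Fin m) → ℝ)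
    (z : Pt n m) : EuclideanSpace ℝ (Fin n) :=
  gradient (fun x => f x z.snd) z.fst

/-- The partial gradient of `f` with respect to the maximization variable `y`. -/
def gradY {n m : ℕ} (f : EuclideanSpace ℝ (Fin n) → EuclideanSpace ℝ (Fin m) → ℝ)
    (z : Pt n m) : EuclideanSpace ℝ (Fin m) :=
  gradient (fun y => f z.fst y) z.snd

/-- One step of two-time-scale gradient descent ascent with an exact gradient oracle. -/
def gdaStep {n m : ℕ} (f : EuclideanSpace ℝ (Fin n) → EuclideanSpace ℝ (Fin m) → ℝ)
    (ηx ηy : ℝ) (z : Pt n m) : Pt n m :=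
  WithLp.toLp 2 (z.fst - ηx • gradX f z, z.snd + ηy • gradY f z)

/-- One step of two-time-scale extra-gradient with an exact gradient oracle: the gradients are
evaluated at the half step and applied at the current point. -/
def egStep {n m : ℕ} (f : EuclideanSpace ℝ (Fin n) → EuclideanSpace ℝ (Fin m) → ℝ)
    (ηx ηy : ℝ) (z : Pt n m) : Pt n m :=
  WithLp.toLp 2
    (z.fst - ηx • gradX f (gdaStep f ηx ηy z), z.snd + ηy • gradY f (gdaStep f ηx ηy z))

/-- The two algorithms: gradient descent ascent and extra-gradient. -/
inductive Algo : Type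
  | gda : Algo
  | eg : Algo

/-- One iteration of the algorithm. -/
def Algo.step {n m : ℕ} (alg : Algo)
    (f : EuclideanSpace ℝ (Fin n) → EuclideanSpace ℝ (Fin m) → ℝ)
    (ηx ηy : ℝ) (z : Pt n m) : Pt n m :=
  match alg with
  | Algo.gda => gdaStep f ηx ηy z
  | Algo.eg => egStep f ηx ηy z

/-- The number of gradient evaluations in one iteration. -/
def Algo.gradCalls (alg : Algo) : ℕ :=
  match alg with
  | Algo.gda => 1
  | Algo.eg => 2

/-- The iterate `z^T` started at `z⁰`. -/
def Algo.iterate {n m : ℕ} (alg : Algo)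
    (f : EuclideanSpace ℝ (Fin n) → EuclideanSpace ℝ (Fin m) → ℝ)
    (ηx ηy : ℝ) (z₀ : Pt n m) (T : ℕ) : Pt n m :=
  (alg.step f ηx ηy)^[T] z₀

/-- The quadratic function
`f(x; y) = -½ (y-y*)ᵀ A (y-y*) + (x-x*)ᵀ B (y-y*) + ½ (x-x*)ᵀ C (x-x*)`. -/
def quadratic {n m : ℕ} (A : Matrix (Fin m) (Fin m) ℝ) (B : Matrix (Fin n) (Fin m) ℝ)
    (C : Matrix (Fin n) (Fin n) ℝ) (zs : Pt n m)
    (x : EuclideanSpace ℝ (Fin n)) (y : EuclideanSpace ℝ (Fin m)) : ℝ :=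
  -(1 / 2) * ((y - zs.snd).ofLp ⬝ᵥ (A.mulVec (y - zs.snd).ofLp))
    + (x - zs.fst).ofLp ⬝ᵥ (B.mulVec (y - zs.snd).ofLp)
    + (1 / 2) * ((x - zs.fst).ofLp ⬝ᵥ (C.mulVec (x - zs.fst).ofLp))

/-- The standing assumptions on the quadratic function: `A`, `C` are symmetric,
`μ I ≤ A ≤ L I`, `‖B‖₂, ‖C‖₂ ≤ L`, `C + B A⁻¹ Bᵀ ≥ μₓ I`, with `μ > 0` and `0 < μₓ ≤ L`. The norms
are spectral norms. -/
structure QuadAssumption {n m : ℕ} (A : Matrix (Fin m) (Fin m) ℝ) (B : Matrix (Fin n) (Fin m) ℝ)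
    (C : Matrix (Fin n) (Fin n) ℝ) (L μ μx : ℝ) : Prop where
  symm_A : A.IsSymm
  symm_C : C.IsSymm
  mu_pos : 0 < μ
  mu_le : (A - μ • (1 : Matrix (Fin m) (Fin m) ℝ)).PosSemidef
  le_L : (L • (1 : Matrix (Fin m) (Fin m) ℝ) - A).PosSemidef
  norm_B : ‖B‖ ≤ L
  norm_C : ‖C‖ ≤ L
  mux_pos : 0 < μx
  mux_le_L : μx ≤ L
  mux_le : (C + B * A⁻¹ * B.transpose - μx • (1 : Matrix (Fin n) (Fin n) ℝ)).PosSemidef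

/-- The matrix `M = [[-C, -B], [r Bᵀ, -r A]]` governing the dynamics. -/
def dynMatrix {n m : ℕ} (A : Matrix (Fin m) (Fin m) ℝ) (B : Matrix (Fin n) (Fin m) ℝ)
    (C : Matrix (Fin n) (Fin n) ℝ) (r : ℝ) : Matrix (Fin n ⊕ Fin m) (Fin n ⊕ Fin m) ℝ :=
  Matrix.fromBlocks (-C) (-B) (r • B.transpose) (-(r • A))

/-- The Jordan block of size `d` with eigenvalue `lam`: `lam` on the diagonal, `1` on the
superdiagonal. -/
def jordanBlock (lam : ℂ) (d : ℕ) : Matrix (Fin d) (Fin d) ℂ :=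
  Matrix.of fun i j =>
    if i = j then lam else if (i : ℕ) + 1 = (j : ℕ) then 1 else 0

/-- A Jordan decomposition `M = P⁻¹ J P` of a complex square matrix: `P` is invertible and `J` is
block diagonal with Jordan blocks, the `i`-th one of size `size i ≥ 1` with eigenvalue `eig i`.
The bijection `e` lists the coordinates block by block. -/
structure JordanDecomp {ι : Type} [Fintype ι] [DecidableEq ι] (M : Matrix ι ι ℂ) where
  numBlocks : ℕ
  size : Fin numBlocks → ℕ
  size_pos : ∀ i, 0 < size i
  eig : Fin numBlocks → ℂ
  e : ι ≃ (Σ i, Fin (size i))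
  P : Matrix ι ι ℂ
  isUnit_P : IsUnit P
  eq : M = P⁻¹ * (Matrix.blockDiagonal' fun i => jordanBlock (eig i) (size i)).submatrix e e * P

/-- The size of the largest Jordan block. -/
def JordanDecomp.maxSize {ι : Type} [Fintype ι] [DecidableEq ι] {M : Matrix ι ι ℂ}
    (D : JordanDecomp M) : ℕ :=
  Finset.univ.sup D.size

/-- The condition number `‖P‖₂ ‖P⁻¹‖₂` in the spectral norm. -/
def JordanDecomp.condP {ι : Type} [Fintype ι] [DecidableEq ι] {M : Matrix ι ι ℂ}
    (D : JordanDecomp M) : ℝ :=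
  ‖D.P‖ * ‖D.P⁻¹‖

end Minimax

end

/-!
Put `η = 1 / (4 r L)`. The error of either algorithm is multiplied in each iteration by
`1 + q(η M)`, where `q = X` for GDA and `q = X + X²` for EG.

Pairing the two block rows of `M w = l w`, `w = (u, v)`, with `u` and `v` locates the spectrum
of `M`. If `l` is not real, the imaginary parts force `‖v‖² = r ‖u‖²`, and then `Re l ≤ -L / 2` and
`(Im l)² ≤ r L²`. If `l` is real, comparing `v` with `A⁻¹ Bᵀ u` and using the bound on
`C + B A⁻¹ Bᵀ` gives `l ≤ -μₓ`. It follows that `‖1 + q(η l)‖ ≤ 1 - 1 / (16 r κₓ)` in both cases.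

For the powers of `1 + Q`, `Q = q(η M)`, write `P Q P⁻¹ = D + G` with `D` diagonal and `G` nilpotent
of order `s`, commuting with `D`. Expanding `(1 + D + G) ^ T` leaves `s` terms, and
`G P = P Q - D P` shows that a factor `G` costs at most `‖D‖ + ‖Q‖ ≤ 1`, so that no power of the
norm of `G` enters the estimate.
-/

namespace Minimax

/-! ### Powers of `1 + Q` for `Q` similar to a commuting sum `D + G` -/

section NormedRing

variable {𝔸 : Type*} [NormedRing 𝔸] {P P' Q D G : 𝔸}

theorem norm_conj_mul_pow_le (hQ : SemiconjBy P Q (D + G)) (hDG : Commute D G)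
    (hnorm : ‖D‖ + ‖Q‖ ≤ 1) (X : 𝔸) (j : ℕ) :
    ‖P' * (X * G ^ j) * P‖ ≤ ‖P‖ * ‖P'‖ * ‖X‖ := by
  induction j generalizing X with
  | zero =>
    rw [pow_zero, mul_one, mul_comm ‖P‖, mul_right_comm]
    exact norm_mul₃_le
  | succ j ih =>
    have hGP : G * P = P * Q - D * P := by rw [hQ.eq, add_mul, add_sub_cancel_left]
    have hstep : P' * (X * G ^ (j + 1)) * P =
        P' * (X * G ^ j) * P * Q - P' * (X * D * G ^ j) * P := by
      calc P' * (X * G ^ (j + 1)) * P = P' * X * G ^ j * (G * P) := by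
            simp only [pow_succ, mul_assoc]
        _ = P' * X * (G ^ j * P) * Q - P' * X * (G ^ j * D) * P := by
            simp only [hGP, mul_sub, mul_assoc]
        _ = P' * (X * G ^ j) * P * Q - P' * (X * D * G ^ j) * P := by
            rw [← (hDG.pow_right j).eq]
            simp only [mul_assoc]
    calc ‖P' * (X * G ^ (j + 1)) * P‖
        ≤ ‖P' * (X * G ^ j) * P‖ * ‖Q‖ + ‖P' * (X * D * G ^ j) * P‖ := by
          rw [hstep]
          exact (norm_sub_le _ _).trans (by gcongr; exact norm_mul_le _ _)
      _ ≤ ‖P‖ * ‖P'‖ * ‖X‖ * ‖Q‖ + ‖P‖ * ‖P'‖ * (‖X‖ * ‖D‖) := by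
          gcongr
          · exact ih X
          · exact (ih _).trans (by gcongr; exact norm_mul_le _ _)
      _ = ‖P‖ * ‖P'‖ * ‖X‖ * (‖D‖ + ‖Q‖) := by ring
      _ ≤ ‖P‖ * ‖P'‖ * ‖X‖ := mul_le_of_le_one_right (by positivity) hnorm

theorem one_add_pow_eq_sum_conj (hP : P' * P = 1) (hQ : SemiconjBy P Q (D + G))
    (hDG : Commute D G) {s : ℕ} (hG : G ^ s = 0) (T : ℕ) :
    (1 + Q) ^ T =
      ∑ j ∈ Finset.range s, T.choose j • (P' * ((1 + D) ^ (T - j) * G ^ j) * P) := by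
  have hcomm : Commute G (1 + D) := (Commute.one_right G).add_right hDG.symm
  have hconj : SemiconjBy P (1 + Q) (G + (1 + D)) := by
    rw [add_left_comm, add_comm G]
    exact (SemiconjBy.one_right P).add_right hQ
  calc (1 + Q) ^ T = P' * (G + (1 + D)) ^ T * P := by
        rw [mul_assoc, ← (hconj.pow_right T).eq, ← mul_assoc, hP, one_mul]
    _ = ∑ j ∈ Finset.range (T + 1), T.choose j • (P' * ((1 + D) ^ (T - j) * G ^ j) * P) := by
        simp only [hcomm.add_pow, Finset.mul_sum, Finset.sum_mul, ← nsmul_eq_mul',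
          mul_smul_comm, smul_mul_assoc, (hcomm.pow_pow _ _).eq]
    _ = ∑ j ∈ Finset.range s, T.choose j • (P' * ((1 + D) ^ (T - j) * G ^ j) * P) := by
        refine Finset.sum_congr_of_eq_on_inter (fun j _ hj => ?_) (fun j _ hj => ?_)
          fun _ _ _ => rfl
        · rw [pow_eq_zero_of_le (by simpa using hj) hG]
          simp
        · rw [Nat.choose_eq_zero_of_lt (by simpa [Nat.lt_succ_iff] using hj), zero_smul]

theorem norm_one_add_pow_le_of_semiconjBy [NormOneClass 𝔸] (hP : P' * P = 1)
    (hQ : SemiconjBy P Q (D + G)) (hDG : Commute D G) {s : ℕ} (hG : G ^ s = 0)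
    (hnorm : ‖D‖ + ‖Q‖ ≤ 1) {ρ : ℝ} (hρ : ‖1 + D‖ ≤ ρ) (T : ℕ) :
    ‖(1 + Q) ^ T‖ ≤ ‖P‖ * ‖P'‖ * ∑ j ∈ Finset.range s, (T.choose j : ℝ) * ρ ^ (T - j) := by
  rw [one_add_pow_eq_sum_conj hP hQ hDG hG, Finset.mul_sum]
  refine norm_sum_le_of_le _ fun j _ => ?_
  calc ‖T.choose j • (P' * ((1 + D) ^ (T - j) * G ^ j) * P)‖
      ≤ T.choose j * ‖P' * ((1 + D) ^ (T - j) * G ^ j) * P‖ := norm_nsmul_le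
    _ ≤ T.choose j * (‖P‖ * ‖P'‖ * ρ ^ (T - j)) := by
        gcongr
        refine (norm_conj_mul_pow_le hQ hDG hnorm _ _).trans ?_
        gcongr
        exact (norm_pow_le _ _).trans (by gcongr)
    _ = ‖P‖ * ‖P'‖ * (T.choose j * ρ ^ (T - j)) := by ring

end NormedRing

theorem sum_choose_mul_pow_le {ρ : ℝ} (h0 : 0 < ρ) (h1 : ρ ≤ 1) {s T : ℕ} (hT : 1 ≤ T ∨ s = 1) :
    ∑ j ∈ Finset.range s, (T.choose j : ℝ) * ρ ^ (T - j) ≤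
      s * ((T : ℝ) ^ (s - 1) * ρ ^ ((T : ℤ) - (s : ℤ) + 1)) := by
  rw [← nsmul_eq_mul]
  nth_rw 2 [← Finset.card_range s]
  refine Finset.sum_le_card_nsmul _ _ _ fun j hj => ?_
  rw [Finset.mem_range] at hj
  rcases lt_or_ge T j with hTj | hTj
  · rw [Nat.choose_eq_zero_of_lt hTj, Nat.cast_zero, zero_mul]
    positivity
  · have hchoose : (T.choose j : ℝ) ≤ (T : ℝ) ^ (s - 1) := by
      rcases hT with hT | rfl
      · calc (T.choose j : ℝ) ≤ (T : ℝ) ^ j := by exact_mod_cast Nat.choose_le_pow T j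
          _ ≤ (T : ℝ) ^ (s - 1) := pow_le_pow_right₀ (by exact_mod_cast hT) (by lia)
      · obtain rfl : j = 0 := by lia
        simp
    have hpow : ρ ^ (T - j) ≤ ρ ^ ((T : ℤ) - (s : ℤ) + 1) := by
      rw [← zpow_natCast]
      exact zpow_le_zpow_right_of_le_one₀ h0 h1 (by lia)
    gcongr

section Polynomial

open Polynomial

theorem semiconjBy_aeval {R A : Type*} [CommSemiring R] [Semiring A] [Algebra R A] {a x y : A}
    (h : SemiconjBy a x y) (q : R[X]) : SemiconjBy a (aeval x q) (aeval y q) := by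
  induction q using Polynomial.induction_on' with
  | add p q hp hq => simpa only [map_add] using hp.add_right hq
  | monomial n c =>
    simpa only [aeval_monomial] using
      SemiconjBy.mul_right (Algebra.commutes c a).symm (h.pow_right n)

variable {R A : Type*} [CommRing R] [Ring A] [Algebra R A] {x y : A}

theorem commute_aeval_aeval_add_sub (h : Commute x y) (q : R[X]) :
    Commute (aeval x q) (aeval (x + y) q - aeval x q) := by
  have hx : Commute (x + y) (aeval x q) := semiconjBy_aeval ((Commute.refl x).add_left h.symm) q
  exact (semiconjBy_aeval (R := R) hx.symm q).sub_right (Commute.refl _)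

open scoped IsMulCommutative in
theorem aeval_add_sub_aeval_pow_eq_zero (h : Commute x y) {s : ℕ} (hy : y ^ s = 0) (q : R[X]) :
    (aeval (x + y) q - aeval x q) ^ s = 0 := by
  let S := Algebra.adjoin R {x, y}
  have : IsMulCommutative S := Algebra.isMulCommutative_adjoin R <| by
    rintro a (rfl | rfl) b (rfl | rfl) <;> first | rfl | exact h | exact h.symm
  let x' : S := ⟨x, Algebra.subset_adjoin (by simp)⟩
  let y' : S := ⟨y, Algebra.subset_adjoin (by simp)⟩
  have hdvd : y' ∣ aeval (x' + y') q - aeval x' q := by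
    simpa [eval_map_algebraMap] using
      sub_dvd_eval_sub (x' + y') x' (q.map (algebraMap R S))
  have hy' : y' ^ s = 0 := Subtype.ext hy
  have hpow : (aeval (x' + y') q - aeval x' q) ^ s = 0 :=
    eq_zero_of_zero_dvd (hy' ▸ pow_dvd_pow_of_dvd hdvd s)
  simpa [x', y'] using congrArg S.val hpow

end Polynomial

/-! ### Jordan decompositions -/

theorem jordanBlock_zero_pow_apply_ne_zero {d : ℕ} (k : ℕ) {i j : Fin d}
    (h : (jordanBlock 0 d ^ k) i j ≠ 0) : (i : ℕ) + k = j := by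
  induction k generalizing j with
  | zero =>
    obtain rfl : i = j := by_contra fun hij => h (Matrix.one_apply_ne hij)
    rfl
  | succ k ih =>
    rw [pow_succ, Matrix.mul_apply] at h
    obtain ⟨l, -, hl⟩ := Finset.exists_ne_zero_of_sum_ne_zero h
    have hil := ih (left_ne_zero_of_mul hl)
    have hlj : (l : ℕ) + 1 = j := by
      have := right_ne_zero_of_mul hl
      simp only [jordanBlock, Matrix.of_apply] at this
      grind
    lia

theorem jordanBlock_zero_pow_eq_zero {d k : ℕ} (hk : d ≤ k) : jordanBlock 0 d ^ k = 0 := by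
  ext i j
  by_contra h
  have := jordanBlock_zero_pow_apply_ne_zero k h
  lia

theorem jordanBlock_eq_diagonal_add (l : ℂ) (d : ℕ) :
    jordanBlock l d = Matrix.diagonal (fun _ => l) + jordanBlock 0 d := by
  ext i j
  by_cases hij : i = j <;> simp [jordanBlock, hij]

namespace JordanDecomp

open Polynomial

variable {ι : Type} [Fintype ι] [DecidableEq ι] {M : Matrix ι ι ℂ} (D : JordanDecomp M)

/-- The diagonal part of the Jordan matrix `J`. -/
def diagPart : Matrix ι ι ℂ :=
  Matrix.diagonal fun x => D.eig (D.e x).1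

/-- The strictly upper triangular part of the Jordan matrix `J`. -/
def nilPart : Matrix ι ι ℂ :=
  (Matrix.blockDiagonal' fun i => jordanBlock 0 (D.size i)).submatrix D.e D.e

theorem diagPart_add_nilPart :
    D.diagPart + D.nilPart =
      (Matrix.blockDiagonal' fun i => jordanBlock (D.eig i) (D.size i)).submatrix D.e D.e := by
  have hsplit : (fun i => jordanBlock (D.eig i) (D.size i)) =
      (fun i => Matrix.diagonal fun _ => D.eig i) + fun i => jordanBlock 0 (D.size i) :=
    funext fun i => jordanBlock_eq_diagonal_add _ _
  rw [hsplit, Matrix.blockDiagonal'_add, Matrix.blockDiagonal'_diagonal, Matrix.submatrix_add,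
    Pi.add_apply, Pi.add_apply, Matrix.submatrix_diagonal_equiv]
  rfl

theorem commute_diagPart_nilPart : Commute D.diagPart D.nilPart := by
  ext x y
  rw [diagPart, Matrix.diagonal_mul, Matrix.mul_diagonal, nilPart, Matrix.submatrix_apply]
  by_cases hxy : (D.e x).1 = (D.e y).1
  · rw [hxy, mul_comm]
  · rw [Matrix.blockDiagonal'_apply, dif_neg hxy, mul_zero, zero_mul]

theorem nilPart_pow_maxSize : D.nilPart ^ D.maxSize = 0 := by
  have hblocks : (fun i => jordanBlock 0 (D.size i)) ^ D.maxSize = 0 :=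
    funext fun i => jordanBlock_zero_pow_eq_zero (Finset.le_sup (Finset.mem_univ i))
  have hreindex : D.nilPart = Matrix.reindexAlgEquiv ℂ ℂ D.e.symm
      (Matrix.blockDiagonal' fun i => jordanBlock 0 (D.size i)) := rfl
  rw [hreindex, ← map_pow, ← Matrix.blockDiagonal'_pow, hblocks, Matrix.blockDiagonal'_zero,
    map_zero]

theorem inv_mul_P : D.P⁻¹ * D.P = 1 :=
  Matrix.nonsing_inv_mul _ ((Matrix.isUnit_iff_isUnit_det _).mp D.isUnit_P)

theorem mul_inv_P : D.P * D.P⁻¹ = 1 :=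
  Matrix.mul_nonsing_inv _ ((Matrix.isUnit_iff_isUnit_det _).mp D.isUnit_P)

theorem semiconjBy_P : SemiconjBy D.P M (D.diagPart + D.nilPart) := by
  rw [diagPart_add_nilPart]
  refine (congrArg (D.P * ·) D.eq).trans ?_
  rw [← mul_assoc, ← mul_assoc, D.mul_inv_P, one_mul]

theorem eig_mem_spectrum (x : ι) : D.eig (D.e x).1 ∈ spectrum ℂ M := by
  set l := D.eig (D.e x).1
  have hl : l ∈ spectrum ℂ D.diagPart := by
    rw [diagPart, spectrum_diagonal]
    exact Set.mem_range_self x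
  refine fun hunit => hl ?_
  have hconj : SemiconjBy D.P (algebraMap ℂ _ l - M)
      (algebraMap ℂ _ l - (D.diagPart + D.nilPart)) :=
    SemiconjBy.sub_right (Algebra.commutes l D.P).symm D.semiconjBy_P
  have hunit' : IsUnit (algebraMap ℂ _ l - (D.diagPart + D.nilPart)) := by
    have hP' : IsUnit D.P⁻¹ := .of_mul_eq_one _ D.inv_mul_P
    rw [← mul_one (_ - _), ← D.mul_inv_P, ← mul_assoc, ← hconj.eq]
    exact (D.isUnit_P.mul hunit).mul hP'
  have hcomm : Commute D.nilPart (algebraMap ℂ _ l - (D.diagPart + D.nilPart)) :=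
    Commute.sub_right (Algebra.commutes l D.nilPart).symm
      (D.commute_diagPart_nilPart.symm.add_right (Commute.refl _))
  simpa [sub_add_eq_sub_sub, spectrum.mem_resolventSet_iff] using
    IsNilpotent.isUnit_add_left_of_commute ⟨_, D.nilPart_pow_maxSize⟩ hunit' hcomm

theorem aeval_diagPart (q : ℂ[X]) :
    aeval D.diagPart q = Matrix.diagonal fun x => q.eval (D.eig (D.e x).1) := by
  have h := aeval_algHom_apply (Matrix.diagonalAlgHom ℂ) (fun x => D.eig (D.e x).1) q
  rw [Matrix.diagonalAlgHom_apply] at h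
  rw [diagPart, h, Matrix.diagonalAlgHom_apply]
  congr 1
  ext x
  rw [aeval_pi_apply₂, coe_aeval_eq_eval]

section Nonempty

variable [Nonempty ι]

theorem maxSize_pos : 0 < D.maxSize :=
  let x := Classical.arbitrary ι
  (D.size_pos (D.e x).1).trans_le (Finset.le_sup (f := D.size) (Finset.mem_univ _))

theorem one_le_condP : 1 ≤ D.condP := by
  rw [← CStarRing.norm_one (E := Matrix ι ι ℂ), ← D.mul_inv_P]
  exact norm_mul_le _ _

theorem norm_one_add_aeval_pow_le (q : ℂ[X]) {ρ d b : ℝ}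
    (hd : ∀ l ∈ spectrum ℂ M, ‖q.eval l‖ ≤ d) (hρ : ∀ l ∈ spectrum ℂ M, ‖1 + q.eval l‖ ≤ ρ)
    (hb : ‖aeval M q‖ ≤ b) (hdb : d + b ≤ 1) (T : ℕ) :
    ‖(1 + aeval M q) ^ T‖ ≤
      D.condP * ∑ j ∈ Finset.range D.maxSize, (T.choose j : ℝ) * ρ ^ (T - j) := by
  have hconj : SemiconjBy D.P (aeval M q) (aeval D.diagPart q +
      (aeval (D.diagPart + D.nilPart) q - aeval D.diagPart q)) := by
    rw [add_sub_cancel]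
    exact semiconjBy_aeval D.semiconjBy_P q
  have hnorm : ‖aeval D.diagPart q‖ ≤ d := by
    rw [aeval_diagPart, Matrix.l2_opNorm_diagonal, pi_norm_le_iff_of_nonempty]
    exact fun x => hd _ (D.eig_mem_spectrum x)
  have hnorm_add : ‖1 + aeval D.diagPart q‖ ≤ ρ := by
    rw [aeval_diagPart, ← Matrix.diagonal_one, Matrix.diagonal_add, Matrix.l2_opNorm_diagonal,
      pi_norm_le_iff_of_nonempty]
    exact fun x => hρ _ (D.eig_mem_spectrum x)
  exact norm_one_add_pow_le_of_semiconjBy D.inv_mul_P hconj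
    (commute_aeval_aeval_add_sub D.commute_diagPart_nilPart q)
    (aeval_add_sub_aeval_pow_eq_zero D.commute_diagPart_nilPart D.nilPart_pow_maxSize q)
    ((add_le_add hnorm hb).trans hdb) hnorm_add T

end Nonempty

end JordanDecomp

/-! ### Spectral norms and complexification of real matrices -/

section

open Matrix
open scoped InnerProductSpace

section MatrixNorm

variable {ι ι' κ κ' 𝕜 : Type*} [Fintype ι] [Fintype ι'] [Fintype κ] [Fintype κ'] [RCLike 𝕜]

theorem norm_sq_toLp_sumElim (u : ι → 𝕜) (v : κ → 𝕜) :
    ‖(WithLp.toLp 2 (Sum.elim u v) : EuclideanSpace 𝕜 (ι ⊕ κ))‖ ^ 2 =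
      ‖(WithLp.toLp 2 u : EuclideanSpace 𝕜 ι)‖ ^ 2 +
        ‖(WithLp.toLp 2 v : EuclideanSpace 𝕜 κ)‖ ^ 2 := by
  simp [EuclideanSpace.norm_sq_eq]

variable [DecidableEq κ] [DecidableEq κ']

theorem l2_opNorm_le_of_sq_le {M : Matrix ι κ 𝕜} {K : ℝ} (hK : 0 ≤ K)
    (h : ∀ x, ‖M.toEuclideanLin x‖ ^ 2 ≤ K ^ 2 * ‖x‖ ^ 2) : ‖M‖ ≤ K :=
  ContinuousLinearMap.opNorm_le_bound _ hK fun x =>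
    abs_le_of_sq_le_sq' ((h x).trans_eq (mul_pow _ _ _).symm) (by positivity) |>.2

theorem norm_mulVec_add_mulVec_sq_le {A : Matrix ι κ 𝕜} {B : Matrix ι κ' 𝕜} {a : ℝ}
    (hA : ‖A‖ ≤ a) (hB : ‖B‖ ≤ a) (u : κ → 𝕜) (v : κ' → 𝕜) :
    ‖(WithLp.toLp 2 (A *ᵥ u + B *ᵥ v) : EuclideanSpace 𝕜 ι)‖ ^ 2 ≤
      2 * a ^ 2 * ‖(WithLp.toLp 2 (Sum.elim u v) : EuclideanSpace 𝕜 (κ ⊕ κ'))‖ ^ 2 := by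
  have hu := (A.l2_opNorm_mulVec (WithLp.toLp 2 u)).trans
    (mul_le_mul_of_nonneg_right hA (norm_nonneg _))
  have hv := (B.l2_opNorm_mulVec (WithLp.toLp 2 v)).trans
    (mul_le_mul_of_nonneg_right hB (norm_nonneg _))
  rw [norm_sq_toLp_sumElim, mul_assoc, mul_add, ← mul_pow, ← mul_pow]
  refine (pow_le_pow_left₀ (norm_nonneg _) ((norm_add_le _ _).trans (add_le_add hu hv)) 2).trans ?_
  exact add_sq_le

theorem l2_opNorm_fromBlocks_le {A : Matrix ι κ 𝕜} {B : Matrix ι κ' 𝕜} {C : Matrix ι' κ 𝕜}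
    {D : Matrix ι' κ' 𝕜} {a b K : ℝ} (hA : ‖A‖ ≤ a) (hB : ‖B‖ ≤ a) (hC : ‖C‖ ≤ b) (hD : ‖D‖ ≤ b)
    (hK : 0 ≤ K) (habK : 2 * a ^ 2 + 2 * b ^ 2 ≤ K ^ 2) : ‖fromBlocks A B C D‖ ≤ K := by
  refine l2_opNorm_le_of_sq_le hK fun x => ?_
  obtain ⟨u, v, rfl⟩ : ∃ u v, x = WithLp.toLp 2 (Sum.elim u v) :=
    ⟨x.ofLp ∘ Sum.inl, x.ofLp ∘ Sum.inr, by rw [Sum.elim_comp_inl_inr]⟩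
  rw [toLpLin_toLp, toLin'_apply, fromBlocks_mulVec, Sum.elim_comp_inl, Sum.elim_comp_inr,
    norm_sq_toLp_sumElim]
  refine (add_le_add (norm_mulVec_add_mulVec_sq_le hA hB u v)
    (norm_mulVec_add_mulVec_sq_le hC hD u v)).trans ?_
  rw [← add_mul]
  gcongr

theorem l2_opNorm_le_of_posSemidef {S : Matrix κ κ ℝ} {L : ℝ} (hL : 0 ≤ L) (hS : S.PosSemidef)
    (hSL : (L • (1 : Matrix κ κ ℝ) - S).PosSemidef) : ‖S‖ ≤ L := by
  rw [← l2_opNorm_toEuclideanCLM, ContinuousLinearMap.norm_eq_iSup_rayleighQuotient _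
    (isSymmetric_toEuclideanLin_iff.mpr hS.isHermitian)]
  refine ciSup_le fun x => ?_
  have h0 : 0 ≤ ⟪S.toEuclideanLin x, x⟫_ℝ :=
    (isPositive_toEuclideanLin_iff.mpr hS).re_inner_nonneg_left x
  have h1 : ⟪S.toEuclideanLin x, x⟫_ℝ ≤ L * ‖x‖ ^ 2 := by
    have := (isPositive_toEuclideanLin_iff.mpr hSL).re_inner_nonneg_left x
    simpa [inner_sub_left, real_inner_smul_left] using this
  change |⟪S.toEuclideanLin x, x⟫_ℝ / ‖x‖ ^ 2| ≤ L
  rw [abs_of_nonneg (by positivity)]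
  exact div_le_of_le_mul₀ (by positivity) hL h1

end MatrixNorm

section Complexification

variable {ι κ : Type*}

/-- The coordinatewise real part of a complex vector. -/
def reVec (x : EuclideanSpace ℂ ι) : EuclideanSpace ℝ ι :=
  WithLp.toLp 2 fun i => (x i).re

/-- The coordinatewise imaginary part of a complex vector. -/
def imVec (x : EuclideanSpace ℂ ι) : EuclideanSpace ℝ ι :=
  WithLp.toLp 2 fun i => (x i).im

section Apply

variable [Fintype κ] [DecidableEq κ]

/-- The `ℂ`-linear extension of the linear map given by a real matrix. -/
noncomputable def complexLin (M : Matrix ι κ ℝ) : EuclideanSpace ℂ κ →ₗ[ℂ] EuclideanSpace ℂ ι :=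
  (M.map Complex.ofReal).toEuclideanLin

theorem reVec_complexLin (M : Matrix ι κ ℝ) (x : EuclideanSpace ℂ κ) :
    reVec (complexLin M x) = M.toEuclideanLin (reVec x) := by
  ext i
  simp [complexLin, reVec, mulVec, dotProduct]

theorem imVec_complexLin (M : Matrix ι κ ℝ) (x : EuclideanSpace ℂ κ) :
    imVec (complexLin M x) = M.toEuclideanLin (imVec x) := by
  ext i
  simp [complexLin, imVec, mulVec, dotProduct]

theorem complexLin_mul_apply {ι' : Type*} [Fintype ι] [DecidableEq ι] (M : Matrix ι' ι ℝ)
    (N : Matrix ι κ ℝ) (x : EuclideanSpace ℂ κ) :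
    complexLin (M * N) x = complexLin M (complexLin N x) := by
  have h : (M * N).map Complex.ofReal = M.map Complex.ofReal * N.map Complex.ofReal :=
    Matrix.map_mul (f := Complex.ofRealHom)
  exact congrArg (WithLp.toLp 2) ((congrArg (· *ᵥ x.ofLp) h).trans (mulVec_mulVec _ _ _).symm)

theorem complexLin_add_apply (M N : Matrix ι κ ℝ) (x : EuclideanSpace ℂ κ) :
    complexLin (M + N) x = complexLin M x + complexLin N x := by
  rw [complexLin, Matrix.map_add _ Complex.ofReal_add, map_add]
  rfl

theorem adjoint_complexLin [Fintype ι] [DecidableEq ι] (M : Matrix ι κ ℝ) :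
    (complexLin M).adjoint = complexLin Mᵀ := by
  rw [complexLin, ← toEuclideanLin_conjTranspose_eq_adjoint]
  congr 1
  ext i j
  simp

theorem isSymmetric_complexLin {S : Matrix κ κ ℝ} (hS : S.IsSymm) : (complexLin S).IsSymmetric := by
  rw [LinearMap.isSymmetric_iff_isSelfAdjoint, LinearMap.isSelfAdjoint_iff', adjoint_complexLin,
    hS.eq]

end Apply

variable [Fintype ι]

theorem re_inner_eq_add (x y : EuclideanSpace ℂ ι) :
    (⟪x, y⟫_ℂ).re = ⟪reVec x, reVec y⟫_ℝ + ⟪imVec x, imVec y⟫_ℝ := by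
  simp [reVec, imVec, PiLp.inner_apply, ← Finset.sum_add_distrib, mul_comm]

theorem norm_sq_eq_add (x : EuclideanSpace ℂ ι) : ‖x‖ ^ 2 = ‖reVec x‖ ^ 2 + ‖imVec x‖ ^ 2 := by
  rw [← inner_self_eq_norm_sq (𝕜 := ℂ), ← real_inner_self_eq_norm_sq, ← real_inner_self_eq_norm_sq]
  exact re_inner_eq_add x x

variable [Fintype κ] [DecidableEq κ]

theorem norm_map_ofReal_le (M : Matrix ι κ ℝ) : ‖M.map Complex.ofReal‖ ≤ ‖M‖ := by
  refine l2_opNorm_le_of_sq_le (norm_nonneg M) fun x => ?_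
  have hle (y : EuclideanSpace ℝ κ) : ‖M.toEuclideanLin y‖ ^ 2 ≤ ‖M‖ ^ 2 * ‖y‖ ^ 2 := by
    rw [← mul_pow]
    exact pow_le_pow_left₀ (norm_nonneg _) (M.l2_opNorm_mulVec y) 2
  rw [← complexLin, norm_sq_eq_add, reVec_complexLin, imVec_complexLin, norm_sq_eq_add x, mul_add]
  exact add_le_add (hle _) (hle _)

theorem norm_complexLin_le {M : Matrix ι κ ℝ} {L : ℝ} (hM : ‖M‖ ≤ L) (x : EuclideanSpace ℂ κ) :
    ‖complexLin M x‖ ≤ L * ‖x‖ :=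
  ((M.map Complex.ofReal).l2_opNorm_mulVec x).trans
    (mul_le_mul_of_nonneg_right ((norm_map_ofReal_le M).trans hM) (norm_nonneg x))

theorem mul_norm_sq_le_re_inner_complexLin {S : Matrix κ κ ℝ} {c : ℝ}
    (hS : (S - c • (1 : Matrix κ κ ℝ)).PosSemidef) (x : EuclideanSpace ℂ κ) :
    c * ‖x‖ ^ 2 ≤ (⟪x, complexLin S x⟫_ℂ).re := by
  have hreal (y : EuclideanSpace ℝ κ) : c * ‖y‖ ^ 2 ≤ ⟪y, S.toEuclideanLin y⟫_ℝ := by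
    have := (isPositive_toEuclideanLin_iff.mpr hS).re_inner_nonneg_right y
    simpa [inner_sub_right, real_inner_smul_right] using this
  rw [re_inner_eq_add, reVec_complexLin, imVec_complexLin, norm_sq_eq_add, mul_add]
  exact add_le_add (hreal _) (hreal _)

theorem neg_mul_norm_sq_le_re_inner_complexLin {S : Matrix κ κ ℝ} {L : ℝ} (hS : ‖S‖ ≤ L)
    (x : EuclideanSpace ℂ κ) : -(L * ‖x‖ ^ 2) ≤ (⟪x, complexLin S x⟫_ℂ).re := by
  have hle : |(⟪x, complexLin S x⟫_ℂ).re| ≤ ‖x‖ * (L * ‖x‖) :=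
    (Complex.abs_re_le_norm _).trans ((norm_inner_le_norm _ _).trans
      (mul_le_mul_of_nonneg_left (norm_complexLin_le hS x) (norm_nonneg x)))
  linarith [neg_le_of_abs_le hle]

end Complexification

end

/-! ### Eigenvectors of the block operator -/

section BlockEigenvector

open scoped InnerProductSpace ComplexConjugate

variable {E F : Type*} [NormedAddCommGroup E] [InnerProductSpace ℂ E] [NormedAddCommGroup F]
  [InnerProductSpace ℂ F] {A : F →ₗ[ℂ] F} {B : F →ₗ[ℂ] E} {C : E →ₗ[ℂ] E} {u : E} {v : F}
  {l : ℂ} {r L μ : ℝ}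

theorem inner_add_inner_eq (hu : -(C u + B v) = l • u) :
    ⟪u, C u⟫_ℂ + ⟪u, B v⟫_ℂ = -(l * (‖u‖ ^ 2 : ℝ)) := by
  have h := congrArg (inner ℂ u) hu
  rw [inner_neg_right, inner_add_right, inner_smul_right, inner_self_eq_norm_sq_to_K] at h
  rw [← neg_eq_iff_eq_neg, h]
  norm_cast

theorem mul_re_inner_apply_le (hA : A.IsSymmetric) (hμ : 0 ≤ μ) {d : F}
    (hd : μ * ‖d‖ ^ 2 ≤ (⟪d, A d⟫_ℂ).re) : μ * (⟪d, A d⟫_ℂ).re ≤ ‖A d‖ ^ 2 := by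
  have h := norm_sub_sq (𝕜 := ℂ) (A d) ((μ : ℂ) • d)
  have hsymm : (⟪A d, (μ : ℂ) • d⟫_ℂ).re = μ * (⟪d, A d⟫_ℂ).re := by
    rw [inner_smul_right, hA d d, Complex.re_ofReal_mul]
  have hnorm : ‖(μ : ℂ) • d‖ ^ 2 = μ ^ 2 * ‖d‖ ^ 2 := by simp [norm_smul, mul_pow]
  rw [RCLike.re_eq_complex_re, hsymm, hnorm] at h
  linarith [mul_le_mul_of_nonneg_left hd hμ, sq_nonneg ‖A d - (μ : ℂ) • d‖]

theorem re_inner_apply_add (hA : A.IsSymmetric) {d : F} {t : ℝ} (hd : A d = (t : ℂ) • v) :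
    (⟪v + d, A (v + d)⟫_ℂ).re = (⟪v, A v⟫_ℂ).re + 2 * t * ‖v‖ ^ 2 + (⟪d, A d⟫_ℂ).re := by
  have hvAd : (⟪v, A d⟫_ℂ).re = t * ‖v‖ ^ 2 := by
    rw [hd, inner_smul_right, Complex.re_ofReal_mul, inner_self_eq_norm_sq_to_K]
    norm_cast
  have hdAv : (⟪d, A v⟫_ℂ).re = (⟪v, A d⟫_ℂ).re := by
    rw [← hA d v, ← inner_conj_symm, Complex.conj_re]
  simp only [map_add, inner_add_left, inner_add_right, Complex.add_re, hdAv, hvAd]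
  ring

variable [FiniteDimensional ℂ E] [FiniteDimensional ℂ F]

theorem mul_inner_sub_inner_eq (hv : (r : ℂ) • (B.adjoint u - A v) = l • v) :
    r * (conj ⟪u, B v⟫_ℂ - ⟪v, A v⟫_ℂ) = l * (‖v‖ ^ 2 : ℝ) := by
  have h := congrArg (inner ℂ v) hv
  rw [inner_smul_right, inner_sub_right, inner_smul_right, inner_self_eq_norm_sq_to_K,
    LinearMap.adjoint_inner_right, ← inner_conj_symm (B v)] at h
  rw [h]
  norm_cast

theorem norm_sq_eq_mul_of_im_ne_zero (hA : A.IsSymmetric) (hC : C.IsSymmetric)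
    (hu : -(C u + B v) = l • u) (hv : (r : ℂ) • (B.adjoint u - A v) = l • v) (hl : l.im ≠ 0) :
    ‖v‖ ^ 2 = r * ‖u‖ ^ 2 := by
  have hCu : (⟪u, C u⟫_ℂ).im = 0 := hC.im_inner_self_apply u
  have hAv : (⟪v, A v⟫_ℂ).im = 0 := hA.im_inner_self_apply v
  have hu_im := congrArg Complex.im (inner_add_inner_eq hu)
  have hv_im := congrArg Complex.im (mul_inner_sub_inner_eq hv)
  simp only [Complex.add_im, Complex.neg_im, Complex.sub_im, Complex.conj_im,
    Complex.im_ofReal_mul, Complex.im_mul_ofReal, hCu, hAv] at hu_im hv_im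
  apply mul_left_cancel₀ hl
  linear_combination -hv_im - r * hu_im

theorem nonreal_eigenvalue_bounds (hA : A.IsSymmetric) (hC : C.IsSymmetric)
    (hμA : ∀ y, μ * ‖y‖ ^ 2 ≤ (⟪y, A y⟫_ℂ).re) (hLB : ∀ y, ‖B y‖ ≤ L * ‖y‖)
    (hLC : ∀ x, -(L * ‖x‖ ^ 2) ≤ (⟪x, C x⟫_ℂ).re) (hr₀ : 0 < r) (hr : 2 * L ≤ r * μ)
    (huv : u ≠ 0 ∨ v ≠ 0) (hu : -(C u + B v) = l • u)
    (hv : (r : ℂ) • (B.adjoint u - A v) = l • v) (hl : l.im ≠ 0) :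
    l.re ≤ -(L / 2) ∧ l.im ^ 2 ≤ r * L ^ 2 := by
  have hVU := norm_sq_eq_mul_of_im_ne_zero hA hC hu hv hl
  have hu₀ : 0 < ‖u‖ ^ 2 := by
    have : u ≠ 0 := by
      rintro rfl
      simp_all
    positivity
  have hCu : (⟪u, C u⟫_ℂ).im = 0 := hC.im_inner_self_apply u
  have hu_eq := inner_add_inner_eq hu
  have hv_re := congrArg Complex.re (mul_inner_sub_inner_eq hv)
  have hu_re := congrArg Complex.re hu_eq
  have hu_im := congrArg Complex.im hu_eq
  simp only [Complex.add_im, Complex.neg_im, Complex.add_re, Complex.neg_re, Complex.sub_re,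
    Complex.conj_re, Complex.re_ofReal_mul, Complex.re_mul_ofReal, Complex.im_mul_ofReal, hCu, hVU]
    at hu_re hu_im hv_re
  constructor
  · have hsum : (⟪u, C u⟫_ℂ).re + (⟪v, A v⟫_ℂ).re = -2 * l.re * ‖u‖ ^ 2 := by
      apply mul_left_cancel₀ hr₀.ne'
      linear_combination r * hu_re - hv_re
    have hAv := hμA v
    rw [hVU] at hAv
    refine le_of_mul_le_mul_right ?_ hu₀
    linarith [hLC u, mul_le_mul_of_nonneg_right hr hu₀.le]
  · have hle : |(⟪u, B v⟫_ℂ).im| ≤ ‖u‖ * (L * ‖v‖) :=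
      (Complex.abs_im_le_norm _).trans
        ((norm_inner_le_norm _ _).trans (mul_le_mul_of_nonneg_left (hLB v) (norm_nonneg _)))
    have hsq := sq_le_sq.mpr (hle.trans (le_abs_self _))
    refine le_of_mul_le_mul_right ?_ (pow_pos hu₀ 2)
    calc l.im ^ 2 * (‖u‖ ^ 2) ^ 2 = (⟪u, B v⟫_ℂ).im ^ 2 := by
          linear_combination (l.im * ‖u‖ ^ 2 - (⟪u, B v⟫_ℂ).im) * hu_im
      _ ≤ L ^ 2 * ‖u‖ ^ 2 * ‖v‖ ^ 2 := by linarith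
      _ = r * L ^ 2 * (‖u‖ ^ 2) ^ 2 := by rw [hVU]; ring

-- In the notation of `real_eigenvalue_le`, with `l = r t` and `d = z - v`: `U = ‖u‖²`, `V = ‖v‖²`,
-- `a = ⟪v, A v⟫`, `c = ⟪u, C u⟫`, `p = Re ⟪u, B v⟫` and `w = ⟪d, A d⟫`.
theorem le_neg_of_schur_bound {U V a c p w t μx : ℝ} (hμ : 0 < μ) (hμx : 0 < μx) (hμxL : μx ≤ L)
    (hr₀ : 0 < r) (hr : 2 * L ≤ r * μ) (hU : 0 ≤ U) (hV : 0 ≤ V) (hUV : U ≠ 0 ∨ V ≠ 0)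
    (hcp : c + p = -(r * t * U)) (hp : p = a + t * V) (ha : μ * V ≤ a) (hc : -(L * U) ≤ c)
    (hschur : μx * U ≤ c + (a + 2 * t * V + w)) (hw : μ * w ≤ t ^ 2 * V) : r * t ≤ -μx := by
  by_contra! hlt
  have hμt : 0 < μ + t := by
    by_contra! h
    linarith [mul_le_mul_of_nonneg_left h hr₀.le]
  have hVU : (μ + t) * V ≤ (L - r * t) * U := by linarith
  have hUpos : 0 < U := by
    refine hU.lt_of_ne fun hU₀ => ?_
    have hVpos : 0 < V := hV.lt_of_ne' (hUV.resolve_left (· hU₀.symm))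
    rw [← hU₀, mul_zero] at hVU
    exact (mul_pos hμt hVpos).not_ge hVU
  have hkey : μ * (μx + r * t) * U ≤ t * ((μ + t) * V) := by
    linarith [mul_le_mul_of_nonneg_left hschur hμ.le, congrArg (μ * ·) hcp, congrArg (μ * ·) hp]
  have hpos : 0 < μ * (μx + r * t) * U := by
    have : 0 < μx + r * t := by linarith
    positivity
  have ht : 0 < t := pos_of_mul_pos_left (hpos.trans_le hkey) (by positivity)
  have hLt : t * ((μ + t) * V) ≤ t * (L * U) := by
    have : 0 ≤ r * t * U := by positivity
    exact mul_le_mul_of_nonneg_left (by linarith) ht.le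
  have hLpos : 0 < L := hμx.trans_le hμxL
  linarith [mul_le_mul_of_nonneg_right hr (mul_pos ht hUpos).le,
    show 0 < μ * μx * U by positivity, show 0 < L * (t * U) by positivity]

theorem real_eigenvalue_le {μx : ℝ} {z : F} (hA : A.IsSymmetric) (hμ : 0 < μ) (hμx : 0 < μx)
    (hμxL : μx ≤ L) (hμA : ∀ y, μ * ‖y‖ ^ 2 ≤ (⟪y, A y⟫_ℂ).re)
    (hLC : ∀ x, -(L * ‖x‖ ^ 2) ≤ (⟪x, C x⟫_ℂ).re) (hz : A z = B.adjoint u)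
    (hschur : μx * ‖u‖ ^ 2 ≤ (⟪u, C u + B z⟫_ℂ).re) (hr₀ : 0 < r) (hr : 2 * L ≤ r * μ)
    (huv : u ≠ 0 ∨ v ≠ 0) (hu : -(C u + B v) = l • u)
    (hv : (r : ℂ) • (B.adjoint u - A v) = l • v) (hl : l.im = 0) : l.re ≤ -μx := by
  obtain ⟨t, rfl⟩ : ∃ t : ℝ, l = (r * t : ℝ) :=
    ⟨l.re / r, by rw [mul_div_cancel₀ _ hr₀.ne']; exact Complex.ext rfl hl⟩
  set d := z - v with hd
  have hAd : A d = (t : ℂ) • v := by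
    rw [hd, map_sub, hz]
    refine smul_right_injective F (Complex.ofReal_ne_zero.mpr hr₀.ne') (hv.trans ?_)
    rw [Complex.ofReal_mul, mul_smul]
  have hw : μ * (⟪d, A d⟫_ℂ).re ≤ t ^ 2 * ‖v‖ ^ 2 := by
    simpa [hAd, norm_smul, mul_pow] using mul_re_inner_apply_le hA hμ.le (hμA d)
  have huBz : (⟪u, B z⟫_ℂ).re = (⟪v, A v⟫_ℂ).re + 2 * t * ‖v‖ ^ 2 + (⟪d, A d⟫_ℂ).re := by
    rw [← LinearMap.adjoint_inner_left, ← hz, hA z z, ← re_inner_apply_add hA hAd, hd,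
      add_sub_cancel]
  have hu_re := congrArg Complex.re (inner_add_inner_eq hu)
  have hv_re := congrArg Complex.re (mul_inner_sub_inner_eq hv)
  simp only [Complex.add_re, Complex.neg_re, Complex.sub_re, Complex.conj_re,
    Complex.re_ofReal_mul, Complex.ofReal_re] at hu_re hv_re
  rw [inner_add_right, Complex.add_re, huBz] at hschur
  refine le_neg_of_schur_bound hμ hμx hμxL hr₀ hr (sq_nonneg ‖u‖) (sq_nonneg ‖v‖)
    (by simpa using huv) hu_re ?_ (hμA v) (hLC u) hschur hw
  apply mul_left_cancel₀ hr₀.ne'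
  linear_combination hv_re

end BlockEigenvector

/-! ### The spectrum of the dynamics matrix -/

section

open Matrix
open scoped InnerProductSpace

variable {n m : ℕ} {A : Matrix (Fin m) (Fin m) ℝ} {B : Matrix (Fin n) (Fin m) ℝ}
  {C : Matrix (Fin n) (Fin n) ℝ} {L μ μx r : ℝ}

theorem exists_eigenvector_blocks {l : ℂ}
    (hl : l ∈ spectrum ℂ ((dynMatrix A B C r).map Complex.ofReal)) :
    ∃ (u : EuclideanSpace ℂ (Fin n)) (v : EuclideanSpace ℂ (Fin m)), (u ≠ 0 ∨ v ≠ 0) ∧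
      -(complexLin C u + complexLin B v) = l • u ∧
      (r : ℂ) • ((complexLin B).adjoint u - complexLin A v) = l • v := by
  rw [← spectrum_toLin', ← Module.End.hasEigenvalue_iff_mem_spectrum] at hl
  obtain ⟨w, hw⟩ := hl.exists_hasEigenvector
  have hblocks : ((dynMatrix A B C r).map Complex.ofReal) *ᵥ w = l • w := hw.apply_eq_smul
  obtain ⟨u, v, rfl⟩ : ∃ u v, w = Sum.elim u v := ⟨_, _, (Sum.elim_comp_inl_inr w).symm⟩
  have hmap : (dynMatrix A B C r).map Complex.ofReal =
      fromBlocks (-C.map Complex.ofReal) (-B.map Complex.ofReal)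
        ((r : ℂ) • Bᵀ.map Complex.ofReal) (-((r : ℂ) • A.map Complex.ofReal)) := by
    ext (i | i) (j | j) <;> simp [dynMatrix]
  rw [hmap, fromBlocks_mulVec] at hblocks
  refine ⟨WithLp.toLp 2 u, WithLp.toLp 2 v, ?_, ?_, ?_⟩
  · by_contra! hzero
    refine hw.2 ?_
    rw [(WithLp.toLp_eq_zero 2).mp hzero.1, (WithLp.toLp_eq_zero 2).mp hzero.2, Sum.elim_zero_zero]
  · ext i
    have hi := congrFun hblocks (Sum.inl i)
    simpa [complexLin, neg_mulVec, add_comm] using hi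
  · ext i
    have hi := congrFun hblocks (Sum.inr i)
    rw [adjoint_complexLin]
    simpa [complexLin, neg_mulVec, smul_mulVec, ← sub_eq_add_neg, mul_sub] using hi

namespace QuadAssumption

theorem L_pos (h : QuadAssumption A B C L μ μx) : 0 < L :=
  h.mux_pos.trans_le h.mux_le_L

theorem posDef_A (h : QuadAssumption A B C L μ μx) : A.PosDef := by
  have hμ : (μ • (1 : Matrix (Fin m) (Fin m) ℝ)).PosDef := PosDef.one.smul h.mu_pos
  simpa using hμ.add_posSemidef h.mu_le

theorem mu_le_L (h : QuadAssumption A B C L μ μx) (hm : 0 < m) : μ ≤ L := by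
  have hdiag := (h.mu_le.add h.le_L).diag_nonneg (i := ⟨0, hm⟩)
  simpa using hdiag

theorem norm_dynMatrix_map_le (h : QuadAssumption A B C L μ μx) (hr : 2 ≤ r) :
    ‖(dynMatrix A B C r).map Complex.ofReal‖ ≤ 8 / 5 * (r * L) := by
  have hL := h.L_pos
  have hr₀ : 0 < r := two_pos.trans_le hr
  have hA : ‖A‖ ≤ L := l2_opNorm_le_of_posSemidef hL.le h.posDef_A.posSemidef h.le_L
  have hBt : ‖Bᵀ‖ ≤ L := by
    rw [← conjTranspose_eq_transpose_of_trivial, l2_opNorm_conjTranspose]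
    exact h.norm_B
  refine (norm_map_ofReal_le _).trans
    (l2_opNorm_fromBlocks_le (a := L) (b := r * L) ?_ ?_ ?_ ?_ (by positivity) ?_)
  · rw [norm_neg]; exact h.norm_C
  · rw [norm_neg]; exact h.norm_B
  · rw [norm_smul, Real.norm_of_nonneg hr₀.le]; gcongr
  · rw [norm_neg, norm_smul, Real.norm_of_nonneg hr₀.le]; gcongr
  · nlinarith [mul_le_mul_of_nonneg_right (show (4 : ℝ) ≤ r ^ 2 by nlinarith) (sq_nonneg L)]

theorem re_le_of_mem_spectrum_of_im_eq_zero (h : QuadAssumption A B C L μ μx) (hr₀ : 0 < r)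
    (hr : 2 * L ≤ r * μ) {l : ℂ} (hl : l ∈ spectrum ℂ ((dynMatrix A B C r).map Complex.ofReal))
    (him : l.im = 0) : l.re ≤ -μx := by
  obtain ⟨u, v, huv, hu, hv⟩ := exists_eigenvector_blocks hl
  have hA : IsUnit A.det := (isUnit_iff_isUnit_det A).mp h.posDef_A.isUnit
  refine real_eigenvalue_le (z := complexLin (A⁻¹ * Bᵀ) u) (isSymmetric_complexLin h.symm_A)
    h.mu_pos h.mux_pos h.mux_le_L (mul_norm_sq_le_re_inner_complexLin h.mu_le)
    (neg_mul_norm_sq_le_re_inner_complexLin h.norm_C) ?_ ?_ hr₀ hr huv hu hv him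
  · rw [adjoint_complexLin, ← complexLin_mul_apply, mul_nonsing_inv_cancel_left _ _ hA]
  · rw [← complexLin_mul_apply, ← complexLin_add_apply, ← Matrix.mul_assoc]
    exact mul_norm_sq_le_re_inner_complexLin h.mux_le u

theorem bounds_of_mem_spectrum_of_im_ne_zero (h : QuadAssumption A B C L μ μx) (hr₀ : 0 < r)
    (hr : 2 * L ≤ r * μ) {l : ℂ} (hl : l ∈ spectrum ℂ ((dynMatrix A B C r).map Complex.ofReal))
    (him : l.im ≠ 0) : l.re ≤ -(L / 2) ∧ l.im ^ 2 ≤ r * L ^ 2 := by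
  obtain ⟨u, v, huv, hu, hv⟩ := exists_eigenvector_blocks hl
  exact nonreal_eigenvalue_bounds (isSymmetric_complexLin h.symm_A)
    (isSymmetric_complexLin h.symm_C) (mul_norm_sq_le_re_inner_complexLin h.mu_le)
    (norm_complexLin_le h.norm_B)
    (neg_mul_norm_sq_le_re_inner_complexLin h.norm_C) hr₀ hr huv hu hv him

theorem bounds_of_mem_spectrum (h : QuadAssumption A B C L μ μx) (hr₀ : 0 < r)
    (hr : 2 * L ≤ r * μ) {l : ℂ} (hl : l ∈ spectrum ℂ ((dynMatrix A B C r).map Complex.ofReal)) :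
    l.re ≤ -(μx / 2) ∧ l.im ^ 2 ≤ -(2 * r * L * l.re) := by
  have hμx := h.mux_pos
  have hL := h.L_pos
  by_cases him : l.im = 0
  · have hre := h.re_le_of_mem_spectrum_of_im_eq_zero hr₀ hr hl him
    refine ⟨by linarith, ?_⟩
    rw [him]
    nlinarith [mul_pos hr₀ hL]
  · obtain ⟨hre, him_sq⟩ := h.bounds_of_mem_spectrum_of_im_ne_zero hr₀ hr hl him
    refine ⟨by linarith [h.mux_le_L], him_sq.trans ?_⟩
    nlinarith [mul_pos hr₀ hL]

end QuadAssumption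

end

/-! ### Error recursion of the algorithms -/

section

open Matrix Polynomial
open scoped InnerProductSpace

theorem hasGradientAt_half_inner_add_inner {E : Type*} [NormedAddCommGroup E]
    [InnerProductSpace ℝ E] [CompleteSpace E] {S : E →L[ℝ] E} (hS : (S : E →ₗ[ℝ] E).IsSymmetric)
    (s b : E) (c : ℝ) (x : E) :
    HasGradientAt (fun x => 1 / 2 * ⟪x - s, S (x - s)⟫_ℝ + ⟪x - s, b⟫_ℝ + c) (S (x - s) + b) x := by
  have hsub : HasFDerivAt (fun x => x - s) (ContinuousLinearMap.id ℝ E) x :=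
    (hasFDerivAt_id x).sub_const s
  have hquad := (hS.hasStrictFDerivAt_reApplyInnerSelf (x - s)).hasFDerivAt.comp x hsub
  have hlin := hsub.inner ℝ (hasFDerivAt_const b x)
  rw [hasGradientAt_iff_hasFDerivAt]
  refine (((hquad.const_mul (1 / 2)).add hlin).add_const c).congr_fderiv ?_ |>.congr_of_eventuallyEq
    (.of_forall fun y => ?_)
  · ext h
    simp [real_inner_comm]
  · simp [ContinuousLinearMap.reApplyInnerSelf_apply, real_inner_comm]

theorem hasGradientAt_half_dotProduct_add {ι : Type*} [Fintype ι] {S : Matrix ι ι ℝ}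
    (hS : S.IsSymm) (s : EuclideanSpace ℝ ι) (b : ι → ℝ) (c : ℝ) (x : EuclideanSpace ℝ ι) :
    HasGradientAt (fun x : EuclideanSpace ℝ ι =>
        1 / 2 * ((x - s).ofLp ⬝ᵥ S *ᵥ (x - s).ofLp) + (x - s).ofLp ⬝ᵥ b + c)
      (WithLp.toLp 2 (S *ᵥ (x - s).ofLp + b)) x := by
  classical
  have h := hasGradientAt_half_inner_add_inner (S := toEuclideanCLM (𝕜 := ℝ) S)
    (isSymmetric_toEuclideanLin_iff.mpr hS) s (WithLp.toLp 2 b) c x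
  simp only [inner_toEuclideanCLM] at h
  simp only [EuclideanSpace.inner_eq_star_dotProduct, star_trivial, dotProduct_comm b] at h
  exact h

section Iteration

variable {n m : ℕ} {A : Matrix (Fin m) (Fin m) ℝ} {B : Matrix (Fin n) (Fin m) ℝ}
  {C : Matrix (Fin n) (Fin n) ℝ}

theorem gradX_quadratic (hC : C.IsSymm) (zs z : Pt n m) :
    gradX (quadratic A B C zs) z =
      WithLp.toLp 2 (C *ᵥ (z.fst - zs.fst).ofLp + B *ᵥ (z.snd - zs.snd).ofLp) := by
  have h := hasGradientAt_half_dotProduct_add hC zs.fst (B *ᵥ (z.snd - zs.snd).ofLp)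
    (-(1 / 2) * ((z.snd - zs.snd).ofLp ⬝ᵥ A *ᵥ (z.snd - zs.snd).ofLp)) z.fst
  rw [← h.gradient, gradX]
  congr 1
  ext x
  rw [quadratic]
  ring

theorem gradY_quadratic (hA : A.IsSymm) (zs z : Pt n m) :
    gradY (quadratic A B C zs) z =
      WithLp.toLp 2 (Bᵀ *ᵥ (z.fst - zs.fst).ofLp - A *ᵥ (z.snd - zs.snd).ofLp) := by
  have h := hasGradientAt_half_dotProduct_add hA.neg zs.snd (Bᵀ *ᵥ (z.fst - zs.fst).ofLp)
    (1 / 2 * ((z.fst - zs.fst).ofLp ⬝ᵥ C *ᵥ (z.fst - zs.fst).ofLp)) z.snd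
  rw [neg_mulVec, neg_add_eq_sub] at h
  rw [← h.gradient, gradY]
  congr 1
  ext y
  rw [quadratic, neg_mulVec, dotProduct_neg, dotProduct_transpose_mulVec]
  ring

/-- The coordinates of a point of `ℝⁿ × ℝᵐ` as a complex vector. -/
def complexCoords (z : Pt n m) : Fin n ⊕ Fin m → ℂ :=
  Complex.ofRealHom ∘ Sum.elim z.fst.ofLp z.snd.ofLp

theorem norm_toLp_complexCoords (z : Pt n m) :
    ‖(WithLp.toLp 2 (complexCoords z) : EuclideanSpace ℂ (Fin n ⊕ Fin m))‖ = ‖z‖ := by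
  rw [← sq_eq_sq₀ (norm_nonneg _) (norm_nonneg _), WithLp.prod_norm_sq_eq_of_L2,
    EuclideanSpace.norm_sq_eq, EuclideanSpace.norm_sq_eq, EuclideanSpace.norm_sq_eq,
    Fintype.sum_sum_type]
  simp [complexCoords]

theorem complexCoords_gradient_update (hA : A.IsSymm) (hC : C.IsSymm) (zs z p : Pt n m) (η r : ℝ) :
    complexCoords (WithLp.toLp 2 (z.fst - η • gradX (quadratic A B C zs) p,
        z.snd + (r * η) • gradY (quadratic A B C zs) p) - zs : Pt n m) =
      complexCoords (z - zs) +
        ((η : ℂ) • (dynMatrix A B C r).map Complex.ofReal) *ᵥ complexCoords (p - zs) := by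
  have hmap : ((dynMatrix A B C r).map Complex.ofReal) *ᵥ complexCoords (p - zs) =
      Complex.ofRealHom ∘ (dynMatrix A B C r *ᵥ
        Sum.elim (p - zs).fst.ofLp (p - zs).snd.ofLp) :=
    funext fun i => (RingHom.map_mulVec Complex.ofRealHom _ _ i).symm
  rw [smul_mulVec, hmap, gradX_quadratic hC, gradY_quadratic hA, dynMatrix, fromBlocks_mulVec]
  ext (i | i)
  · simp [complexCoords, neg_mulVec]
    ring
  · simp [complexCoords, neg_mulVec, smul_mulVec]
    ring

/-- The polynomial `q` for which one iteration multiplies the error by `1 + q(η M)`. -/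
noncomputable def Algo.increment (alg : Algo) : ℂ[X] :=
  match alg with
  | Algo.gda => X
  | Algo.eg => X + X ^ 2

theorem Algo.complexCoords_step (alg : Algo) (hA : A.IsSymm) (hC : C.IsSymm) (zs z : Pt n m)
    (η r : ℝ) :
    complexCoords (alg.step (quadratic A B C zs) η (r * η) z - zs) =
      (1 + aeval ((η : ℂ) • (dynMatrix A B C r).map Complex.ofReal) alg.increment) *ᵥ
        complexCoords (z - zs) := by
  cases alg
  · rw [step, gdaStep, complexCoords_gradient_update hA hC, increment, aeval_X, add_mulVec,
      one_mulVec]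
  · rw [step, egStep, complexCoords_gradient_update hA hC, gdaStep,
      complexCoords_gradient_update hA hC, increment, map_add, map_pow, aeval_X, add_mulVec,
      one_mulVec, add_mulVec, mulVec_add, mulVec_mulVec, sq]

theorem Algo.complexCoords_iterate (alg : Algo) (hA : A.IsSymm) (hC : C.IsSymm) (zs z : Pt n m)
    (η r : ℝ) (T : ℕ) :
    complexCoords (alg.iterate (quadratic A B C zs) η (r * η) z T - zs) =
      (1 + aeval ((η : ℂ) • (dynMatrix A B C r).map Complex.ofReal) alg.increment) ^ T *ᵥ
        complexCoords (z - zs) := by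
  induction T with
  | zero => simp [iterate]
  | succ T ih =>
    rw [pow_succ', ← mulVec_mulVec, ← ih, iterate, Function.iterate_succ_apply', ← iterate,
      complexCoords_step alg hA hC]

end Iteration

section StableRegion

/-- The region to which the rescaled eigenvalues `η l` belong, for `θ = 1 / (r κₓ)`. Its points `w`
satisfy `‖1 + q(w)‖ ≤ 1 - θ / 16` for the increment polynomials `q` of both algorithms. -/
def stableRegion (θ : ℝ) : Set ℂ :=
  {w | w.re ≤ -(θ / 8) ∧ w.im ^ 2 ≤ -(w.re / 2) ∧ ‖w‖ ≤ 2 / 5}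

variable {θ : ℝ} {w : ℂ}

theorem norm_one_add_le (hθ : 0 ≤ θ) (hw : w ∈ stableRegion θ) : ‖1 + w‖ ≤ 1 - θ / 16 := by
  obtain ⟨hre, him, hnorm⟩ := hw
  have hre_lower := (abs_le.mp ((Complex.abs_re_le_norm w).trans hnorm)).1
  refine (abs_le_of_sq_le_sq' ?_ (by linarith)).2
  rw [Complex.sq_norm, Complex.normSq_apply]
  simp only [Complex.add_re, Complex.add_im, Complex.one_re, Complex.one_im, zero_add]
  nlinarith

theorem norm_one_add_add_sq_le (hθ : 0 ≤ θ) (hw : w ∈ stableRegion θ) :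
    ‖1 + (w + w ^ 2)‖ ≤ 1 - θ / 16 := by
  obtain ⟨hre, him, hnorm⟩ := hw
  have hre_lower := (abs_le.mp ((Complex.abs_re_le_norm w).trans hnorm)).1
  have him_bounds := abs_le.mp ((Complex.abs_im_le_norm w).trans hnorm)
  have hle : ‖1 + (w + w ^ 2)‖ ≤ 1 + w.re + w.re ^ 2 := by
    refine (abs_le_of_sq_le_sq' ?_ (by nlinarith)).2
    rw [Complex.sq_norm, Complex.normSq_apply]
    simp only [Complex.add_re, Complex.add_im, Complex.one_re, Complex.one_im, zero_add, sq,
      Complex.mul_re, Complex.mul_im]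
    have hgap : 0 ≤ w.im ^ 2 * (1 - 2 * w.re * (1 + w.re) - w.im ^ 2) :=
      mul_nonneg (sq_nonneg _) (by nlinarith [him_bounds.1, him_bounds.2])
    linarith
  nlinarith

theorem Algo.norm_one_add_eval_increment_le (alg : Algo) (hθ : 0 ≤ θ) (hw : w ∈ stableRegion θ) :
    ‖1 + alg.increment.eval w‖ ≤ 1 - θ / 16 := by
  cases alg
  · simpa [increment] using norm_one_add_le hθ hw
  · simpa [increment] using norm_one_add_add_sq_le hθ hw

theorem Algo.norm_eval_increment_le (alg : Algo) (hθ : 0 ≤ θ) (hw : w ∈ stableRegion θ) :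
    ‖alg.increment.eval w‖ ≤ 2 / 5 := by
  have hnorm : ‖w‖ ≤ 2 / 5 := hw.2.2
  cases alg
  · simpa [increment] using hnorm
  · have hle : ‖1 + w‖ ≤ 1 := (norm_one_add_le hθ hw).trans (by linarith)
    calc ‖(X + X ^ 2 : ℂ[X]).eval w‖ = ‖w‖ * ‖1 + w‖ := by
          rw [← norm_mul, eval_add, eval_pow, eval_X, mul_add, mul_one, sq]
      _ ≤ 2 / 5 * 1 := mul_le_mul hnorm hle (norm_nonneg _) (by norm_num)
      _ = 2 / 5 := mul_one _

theorem Algo.norm_aeval_increment_le {𝔸 : Type*} [NormedRing 𝔸] [NormedAlgebra ℂ 𝔸] (alg : Algo)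
    {N : 𝔸} (hN : ‖N‖ ≤ 2 / 5) : ‖aeval N alg.increment‖ ≤ 14 / 25 := by
  cases alg
  · simpa [increment] using hN.trans (by norm_num)
  · rw [increment, map_add, map_pow, aeval_X]
    calc ‖N + N ^ 2‖ ≤ ‖N‖ + ‖N‖ ^ 2 :=
          (norm_add_le _ _).trans (add_le_add_right (norm_pow_le' N two_pos) _)
      _ ≤ 2 / 5 + (2 / 5) ^ 2 := by gcongr
      _ = 14 / 25 := by norm_num

end StableRegion

end

/-! ### Linear convergence -/

section

open Matrix Polynomial

variable {n m : ℕ} {A : Matrix (Fin m) (Fin m) ℝ} {B : Matrix (Fin n) (Fin m) ℝ}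
  {C : Matrix (Fin n) (Fin n) ℝ} {L μ μx r : ℝ}

namespace QuadAssumption

theorem one_le_L_div_mux (h : QuadAssumption A B C L μ μx) : 1 ≤ L / μx :=
  (one_le_div₀ h.mux_pos).mpr h.mux_le_L

theorem two_le_of_two_mul_div_le (h : QuadAssumption A B C L μ μx) (hm : 0 < m)
    (hr : 2 * (L / μ) ≤ r) : 2 ≤ r := by
  linarith [(one_le_div₀ h.mu_pos).mpr (h.mu_le_L hm)]

theorem norm_smul_dynMatrix_map_le (h : QuadAssumption A B C L μ μx) (hr : 2 ≤ r) :
    ‖((1 / (4 * r * L) : ℝ) : ℂ) • (dynMatrix A B C r).map Complex.ofReal‖ ≤ 2 / 5 := by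
  have hL := h.L_pos
  rw [norm_smul, Complex.norm_real, Real.norm_of_nonneg (by positivity)]
  calc 1 / (4 * r * L) * ‖(dynMatrix A B C r).map Complex.ofReal‖
      ≤ 1 / (4 * r * L) * (8 / 5 * (r * L)) := by
        gcongr
        exact h.norm_dynMatrix_map_le hr
    _ = 2 / 5 := by
        field_simp
        norm_num

theorem mul_mem_stableRegion (h : QuadAssumption A B C L μ μx) (hm : 0 < m)
    (hr : 2 * (L / μ) ≤ r) {l : ℂ}
    (hl : l ∈ spectrum ℂ ((dynMatrix A B C r).map Complex.ofReal)) :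
    ((1 / (4 * r * L) : ℝ) : ℂ) * l ∈ stableRegion (1 / (r * (L / μx))) := by
  have : Nonempty (Fin n ⊕ Fin m) := ⟨Sum.inr ⟨0, hm⟩⟩
  have hL := h.L_pos
  have hμx := h.mux_pos
  have hr₂ := h.two_le_of_two_mul_div_le hm hr
  have hr₀ : 0 < r := two_pos.trans_le hr₂
  have hrμ : 2 * L ≤ r * μ := by rwa [mul_div_assoc', div_le_iff₀ h.mu_pos] at hr
  obtain ⟨hre, him⟩ := h.bounds_of_mem_spectrum hr₀ hrμ hl
  refine ⟨?_, ?_, ?_⟩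
  · rw [Complex.re_ofReal_mul]
    calc 1 / (4 * r * L) * l.re ≤ 1 / (4 * r * L) * -(μx / 2) := by gcongr
      _ = -(1 / (r * (L / μx)) / 8) := by
        field_simp
        norm_num
  · rw [Complex.re_ofReal_mul, Complex.im_ofReal_mul, mul_pow]
    calc (1 / (4 * r * L)) ^ 2 * l.im ^ 2
        ≤ (1 / (4 * r * L)) ^ 2 * -(2 * r * L * l.re) := by gcongr
      _ = -(1 / (4 * r * L) * l.re / 2) := by
        field_simp
        norm_num
  · refine le_trans ?_ (h.norm_smul_dynMatrix_map_le hr₂)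
    rw [norm_mul, norm_smul]
    gcongr
    exact spectrum.norm_le_norm_of_mem hl

theorem norm_one_add_aeval_increment_pow_le (h : QuadAssumption A B C L μ μx) (hm : 0 < m)
    (hr : 2 * (L / μ) ≤ r) (D : JordanDecomp ((dynMatrix A B C r).map Complex.ofReal))
    (alg : Algo) (T : ℕ) :
    ‖(1 + aeval (((1 / (4 * r * L) : ℝ) : ℂ) • (dynMatrix A B C r).map Complex.ofReal)
        alg.increment) ^ T‖ ≤
      D.condP * ∑ j ∈ Finset.range D.maxSize,
        (T.choose j : ℝ) * (1 - 1 / 16 / (r * (L / μx))) ^ (T - j) := by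
  have : Nonempty (Fin n ⊕ Fin m) := ⟨Sum.inr ⟨0, hm⟩⟩
  have hr₂ := h.two_le_of_two_mul_div_le hm hr
  have hθ : 0 ≤ 1 / (r * (L / μx)) := by
    have := h.one_le_L_div_mux
    positivity
  set η : ℂ := ((1 / (4 * r * L) : ℝ) : ℂ)
  have haeval : aeval ((dynMatrix A B C r).map Complex.ofReal)
      (alg.increment.comp (Polynomial.C η * X)) =
      aeval (η • (dynMatrix A B C r).map Complex.ofReal) alg.increment := by
    rw [aeval_comp, map_mul, aeval_C, aeval_X, Algebra.smul_def]
  have heval (l : ℂ) : (alg.increment.comp (Polynomial.C η * X)).eval l =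
      alg.increment.eval (η * l) := by
    rw [eval_comp, eval_mul, eval_C, eval_X]
  rw [← haeval, div_right_comm]
  refine D.norm_one_add_aeval_pow_le _ (d := 2 / 5) (b := 14 / 25) ?_ ?_ ?_ (by norm_num) T
  · intro l hl
    rw [heval]
    exact alg.norm_eval_increment_le hθ (h.mul_mem_stableRegion hm hr hl)
  · intro l hl
    rw [heval]
    exact alg.norm_one_add_eval_increment_le hθ (h.mul_mem_stableRegion hm hr hl)
  · rw [haeval]
    exact alg.norm_aeval_increment_le (h.norm_smul_dynMatrix_map_le hr₂)

end QuadAssumption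

theorem Algo.norm_iterate_sub_le (alg : Algo) (hm : 0 < m) (h : QuadAssumption A B C L μ μx)
    (hr : 2 * (L / μ) ≤ r) (D : JordanDecomp ((dynMatrix A B C r).map Complex.ofReal))
    (zs z₀ : Pt n m) {T : ℕ} (hT : 1 ≤ T ∨ D.maxSize = 1) :
    ‖alg.iterate (quadratic A B C zs) (1 / (4 * r * L)) (1 / (4 * L)) z₀ T - zs‖ ≤
      D.maxSize * D.condP * ‖z₀ - zs‖ * (T : ℝ) ^ (D.maxSize - 1) *
        (1 - 1 / 16 / (r * (L / μx))) ^ ((T : ℤ) - (D.maxSize : ℤ) + 1) := by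
  have : Nonempty (Fin n ⊕ Fin m) := ⟨Sum.inr ⟨0, hm⟩⟩
  have hr₂ := h.two_le_of_two_mul_div_le hm hr
  have hK : 2 ≤ r * (L / μx) := by nlinarith [h.one_le_L_div_mux]
  have hη : 1 / (4 * L) = r * (1 / (4 * r * L)) := by
    have := h.L_pos
    field_simp
  have hrate₀ : 0 < 1 / 16 / (r * (L / μx)) := by positivity
  have hrate₁ : 1 / 16 / (r * (L / μx)) ≤ 1 / 16 := div_le_self (by norm_num) (by linarith)
  have hsum := sum_choose_mul_pow_le (ρ := 1 - 1 / 16 / (r * (L / μx)))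
    (by linarith) (by linarith) hT
  rw [hη, ← norm_toLp_complexCoords, alg.complexCoords_iterate h.symm_A h.symm_C,
    ← norm_toLp_complexCoords (z₀ - zs)]
  refine (l2_opNorm_mulVec _ (WithLp.toLp 2 (complexCoords (z₀ - zs)))).trans ?_
  refine (mul_le_mul_of_nonneg_right ((h.norm_one_add_aeval_increment_pow_le hm hr D alg T).trans
    (mul_le_mul_of_nonneg_left hsum (zero_le_one.trans D.one_le_condP)))
    (norm_nonneg _)).trans_eq ?_
  ring

end

/-! ### Iteration count -/

theorem log_le_div_sub_one_add_log {x a : ℝ} (hx : 0 < x) (ha : 0 < a) :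
    Real.log x ≤ x / a - 1 + Real.log a := by
  have hle := Real.log_le_sub_one_of_pos (div_pos hx ha)
  rw [Real.log_div hx.ne' ha.ne'] at hle
  linarith

theorem mul_pow_mul_zpow_le_exp {s T : ℕ} (hs : 1 ≤ s) (hsT : s ≤ T) {y δ : ℝ} (hy : 1 ≤ y)
    (hδ₀ : 0 ≤ δ) (hδ₁ : δ ≤ 1) :
    y * (T : ℝ) ^ (s - 1) * (1 - δ) ^ ((T : ℤ) - (s : ℤ) + 1) ≤
      Real.exp (s * (Real.log y + Real.log T + δ) - T * δ) := by
  have hT : (1 : ℝ) ≤ T := by exact_mod_cast hs.trans hsT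
  obtain ⟨N, rfl⟩ := Nat.exists_eq_add_of_le hsT
  have hexponent : ((s + N : ℕ) : ℤ) - (s : ℤ) + 1 = ((N + 1 : ℕ) : ℤ) := by
    push_cast
    ring
  have hdecay : (1 - δ) ^ (N + 1) ≤ Real.exp (N * -δ) := by
    rw [Real.exp_nat_mul]
    calc (1 - δ) ^ (N + 1) ≤ (1 - δ) ^ N :=
          pow_le_pow_of_le_one (sub_nonneg.mpr hδ₁) (by linarith) N.le_succ
      _ ≤ Real.exp (-δ) ^ N := by
          gcongr
          exact Real.one_sub_le_exp_neg δ
  have hpow : ((s + N : ℕ) : ℝ) ^ (s - 1) ≤ Real.exp (s * Real.log ((s + N : ℕ) : ℝ)) := by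
    rw [Real.exp_nat_mul, Real.exp_log (by linarith)]
    exact pow_le_pow_right₀ hT (s.sub_le 1)
  have hbase : y ≤ Real.exp (s * Real.log y) := by
    rw [Real.exp_nat_mul, Real.exp_log (by linarith)]
    exact le_self_pow₀ hy (by omega)
  rw [hexponent, zpow_natCast]
  calc y * ((s + N : ℕ) : ℝ) ^ (s - 1) * (1 - δ) ^ (N + 1)
      ≤ Real.exp (s * Real.log y) * Real.exp (s * Real.log ((s + N : ℕ) : ℝ)) *
          Real.exp (N * -δ) := by
        have := pow_nonneg (sub_nonneg.mpr hδ₁) (N + 1)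
        gcongr
    _ = _ := by
        rw [← Real.exp_add, ← Real.exp_add]
        push_cast
        ring_nf

section IterationCount

variable {s : ℕ} {K Y : ℝ}

theorem two_le_natCast_mul (hs : 1 ≤ s) (hK : 2 ≤ K) : 2 ≤ s * K := by
  have hs' : (1 : ℝ) ≤ s := by exact_mod_cast hs
  nlinarith

theorem log_two_le_log_mul (hs : 1 ≤ s) (hK : 2 ≤ K) (hY : 1 ≤ Y) :
    Real.log 2 ≤ Real.log (s * K * Y) := by
  have hX := two_le_natCast_mul hs hK
  exact Real.log_le_log two_pos (by nlinarith)

-- With `a = T / (32 s K)`, the tangent line gives `log T ≤ a - 1 + log (32 s K)`; the constant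
-- `224 = 7 * 32` makes `a` absorb every remaining logarithm.
theorem log_add_log_add_le {T : ℕ} (hs : 1 ≤ s) (hK : 2 ≤ K) (hY : 1 ≤ Y)
    (hT : 224 * (s * K * Real.log (s * K * Y)) ≤ T) :
    Real.log (s * Y) + Real.log T + 1 / 16 / K ≤ T / (16 * (s * K)) := by
  have hX := two_le_natCast_mul hs hK
  have hlog₂ := log_two_le_log_mul hs hK hY
  have hlog_sY : Real.log (s * Y) ≤ Real.log (s * K * Y) :=
    Real.log_le_log (by positivity) (by gcongr; nlinarith)
  have hlog_X : Real.log (s * K) ≤ Real.log (s * K * Y) :=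
    Real.log_le_log (by positivity) (le_mul_of_one_le_right (by positivity) hY)
  have hlog_pos : 0 < Real.log (s * K * Y) := (Real.log_pos one_lt_two).trans_le hlog₂
  have hT₀ : (0 : ℝ) < T := hT.trans_lt' (by positivity)
  have hlog_T := log_le_div_sub_one_add_log hT₀ (show 0 < 2 ^ 5 * (s * K) by positivity)
  rw [Real.log_mul (by norm_num) (by positivity), Real.log_pow] at hlog_T
  have hT_div : 7 * Real.log (s * K * Y) ≤ T / (2 ^ 5 * (s * K)) := by
    rw [le_div_iff₀ (by positivity)]
    linarith
  have hdiv : (T : ℝ) / (16 * (s * K)) = 2 * (T / (2 ^ 5 * (s * K))) := by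
    field_simp
    norm_num
  have hK_div : 1 / 16 / K ≤ 1 / 16 := div_le_self (by norm_num) (by linarith)
  push_cast at hlog_T
  linarith [Real.log_two_gt_d9]

theorem mul_pow_mul_zpow_le_one {T : ℕ} (hs : 1 ≤ s) (hK : 2 ≤ K) (hY : 1 ≤ Y)
    (hT : 224 * (s * K * Real.log (s * K * Y)) ≤ T) :
    1 ≤ T ∧ s * Y * (T : ℝ) ^ (s - 1) * (1 - 1 / 16 / K) ^ ((T : ℤ) - (s : ℤ) + 1) ≤ 1 := by
  have hs' : (1 : ℝ) ≤ s := by exact_mod_cast hs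
  have hlog₂ := log_two_le_log_mul hs hK hY
  have hsT : s ≤ T := by
    have hK_log : 1 ≤ K * Real.log (s * K * Y) := by nlinarith [Real.log_two_gt_d9]
    have hs_le : (s : ℝ) ≤ T := by linarith [mul_le_mul_of_nonneg_left hK_log s.cast_nonneg]
    exact_mod_cast hs_le
  have hK_div : 1 / 16 / K ≤ 1 / 16 := div_le_self (by norm_num) (by linarith)
  refine ⟨hs.trans hsT, (mul_pow_mul_zpow_le_exp hs hsT (one_le_mul_of_one_le_of_one_le hs' hY)
    (by positivity) (by linarith)).trans (Real.exp_le_one_iff.mpr (sub_nonpos.mpr ?_))⟩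
  calc s * (Real.log (s * Y) + Real.log T + 1 / 16 / K) ≤ s * (T / (16 * (s * K))) := by
        gcongr
        exact log_add_log_add_le hs hK hY hT
    _ = T * (1 / 16 / K) := by field_simp

theorem exists_iteration_count (hs : 1 ≤ s) (hK : 2 ≤ K) (hY : 1 ≤ Y) :
    ∃ T₀ : ℕ, 2 * (T₀ : ℝ) ≤ 450 * (s * K * Real.log (s * K * Y)) ∧ ∀ T : ℕ, T₀ ≤ T →
      1 ≤ T ∧ s * Y * (T : ℝ) ^ (s - 1) * (1 - 1 / 16 / K) ^ ((T : ℤ) - (s : ℤ) + 1) ≤ 1 := by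
  have hW : 1 ≤ s * K * Real.log (s * K * Y) := by
    nlinarith [two_le_natCast_mul hs hK, log_two_le_log_mul hs hK hY, Real.log_two_gt_d9]
  refine ⟨⌈224 * (s * K * Real.log (s * K * Y))⌉₊, ?_, fun T hT =>
    mul_pow_mul_zpow_le_one hs hK hY (Nat.ceil_le.mp hT)⟩
  linarith [Nat.ceil_lt_add_one (show 0 ≤ 224 * (s * K * Real.log (s * K * Y)) by linarith)]

end IterationCount

theorem Algo.gradCalls_le (alg : Algo) : alg.gradCalls ≤ 2 := by
  cases alg <;> simp [gradCalls]

theorem Algo.exists_forall_norm_iterate_sub_le {n m : ℕ} {A : Matrix (Fin m) (Fin m) ℝ}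
    {B : Matrix (Fin n) (Fin m) ℝ} {C : Matrix (Fin n) (Fin n) ℝ} {L μ μx r : ℝ} (alg : Algo)
    (hm : 0 < m) (h : QuadAssumption A B C L μ μx) (hr : 2 * (L / μ) ≤ r)
    (D : JordanDecomp ((dynMatrix A B C r).map Complex.ofReal)) (zs z₀ : Pt n m) {ε : ℝ}
    (hε : 0 < ε) (hεz : ε ≤ ‖z₀ - zs‖) :
    ∃ T₀ : ℕ,
      ((alg.gradCalls * T₀ : ℕ) : ℝ) ≤
        450 * (D.maxSize * r * (L / μx) *
          Real.log (D.maxSize * r * (L / μx) * D.condP * ‖z₀ - zs‖ / ε)) ∧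
      ∀ T : ℕ, T₀ ≤ T →
        ‖alg.iterate (quadratic A B C zs) (1 / (4 * r * L)) (1 / (4 * L)) z₀ T - zs‖ ≤ ε := by
  have : Nonempty (Fin n ⊕ Fin m) := ⟨Sum.inr ⟨0, hm⟩⟩
  have hK : 2 ≤ r * (L / μx) := by
    nlinarith [h.two_le_of_two_mul_div_le hm hr, h.one_le_L_div_mux]
  have hY : 1 ≤ D.condP * (‖z₀ - zs‖ / ε) :=
    one_le_mul_of_one_le_of_one_le D.one_le_condP ((one_le_div₀ hε).mpr hεz)
  have hlog_arg : D.maxSize * r * (L / μx) * D.condP * ‖z₀ - zs‖ / ε =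
      D.maxSize * (r * (L / μx)) * (D.condP * (‖z₀ - zs‖ / ε)) := by ring
  obtain ⟨T₀, hcalls, hT₀⟩ := exists_iteration_count D.maxSize_pos hK hY
  rw [hlog_arg, mul_assoc (D.maxSize : ℝ) r]
  refine ⟨T₀, le_trans ?_ hcalls, fun T hT => ?_⟩
  · rw [Nat.cast_mul]
    gcongr
    exact_mod_cast alg.gradCalls_le
  · obtain ⟨hT₁, hfactor⟩ := hT₀ T hT
    refine (alg.norm_iterate_sub_le hm h hr D zs z₀ (.inl hT₁)).trans ?_
    calc _ = (D.maxSize * (D.condP * (‖z₀ - zs‖ / ε)) * (T : ℝ) ^ (D.maxSize - 1) *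
          (1 - 1 / 16 / (r * (L / μx))) ^ ((T : ℤ) - (D.maxSize : ℤ) + 1)) * ε := by
          field_simp
      _ ≤ ε := mul_le_of_le_one_left hε.le hfactor

end Minimax

theorem theorem5 :
    ∃ c₀ c₁ : ℝ, 0 < c₀ ∧ c₀ < 1 ∧ 0 < c₁ ∧
      ∀ (n m : ℕ) (_ : 0 < m)
        (A : Matrix (Fin m) (Fin m) ℝ) (B : Matrix (Fin n) (Fin m) ℝ)
        (C : Matrix (Fin n) (Fin n) ℝ) (zs : Minimax.Pt n m)
        (L μ μx κ κx r : ℝ)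
        (_ : Minimax.QuadAssumption A B C L μ μx)
        (_ : κ = L / μ) (_ : κx = L / μx) (_ : 2 * κ ≤ r)
        (D : Minimax.JordanDecomp ((Minimax.dynMatrix A B C r).map Complex.ofReal))
        (alg : Minimax.Algo) (z₀ : Minimax.Pt n m),
        (∀ T : ℕ, (1 ≤ T ∨ D.maxSize = 1) →
          ‖alg.iterate (Minimax.quadratic A B C zs) (1 / (4 * r * L)) (1 / (4 * L)) z₀ T - zs‖ ≤
            D.maxSize * D.condP * ‖z₀ - zs‖ * (T : ℝ) ^ (D.maxSize - 1) *
              (1 - c₀ / (r * κx)) ^ ((T : ℤ) - (D.maxSize : ℤ) + 1)) ∧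
        (∀ ε : ℝ, 0 < ε → ε ≤ ‖z₀ - zs‖ →
          ∃ T₀ : ℕ,
            ((alg.gradCalls * T₀ : ℕ) : ℝ) ≤
              c₁ * (D.maxSize * r * κx *
                Real.log (D.maxSize * r * κx * D.condP * ‖z₀ - zs‖ / ε)) ∧
            ∀ T : ℕ, T₀ ≤ T →
              ‖alg.iterate (Minimax.quadratic A B C zs) (1 / (4 * r * L)) (1 / (4 * L)) z₀ T
                - zs‖ ≤ ε) := by
  refine ⟨1 / 16, 450, by norm_num, by norm_num, by norm_num, ?_⟩
  rintro n m hm A B C zs L μ μx κ κx r h rfl rfl hr D alg z₀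
  exact ⟨fun T hT => alg.norm_iterate_sub_le hm h hr D zs z₀ hT,
    fun ε hε hεz => alg.exists_forall_norm_iterate_sub_le hm h hr D zs z₀ hε hεz⟩
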